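/- **Theorem (Triggering Interval).** Let $\mathcal G=(\mathcal V,\mathcal E)$ be a finite undirected simple graph, with neighbour sets $\mathcal N_i$. Let $\theta\in\mathbb R^n$, and let each agent $i\in\mathcal V$ have measurements $y_i(t)=H_i\theta+v_i(t)$, $t\in\mathbb N=\{0,1,2,\dots\}$, where $H_i\in\mathbb R^{m_i\times n}$ and, for each $i$, the random vectors $v_i(0),v_i(1),\dots$ in $\mathbb R^{m_i}$ are i.i.d. with mean zero (the noises of different agents may be dependent). Fix threshold exponents $\rho_i>0$. For every agent $i$, time $0$ is a triggering instant, and a time $t\ge 1$ is a triggering instant if and only if $$\|x_i(t)-x_i(s)\|>\frac1{(t+1)^{\rho_i}},$$ where $s$ is the latest triggering instant of agent $i$ before $t$. Write $\hat x_i(t)=x_i(s')$, where $s'$ is the latest triggering instant of agent $i$ with $s'\le t$, for the estimate most recently sent out by agent $i$. With arbitrary (possibly random) initial values $x_i(0)\in\mathbb R^n$, the estimates are given by $$x_i(t+1)=x_i(t)+\alpha(t)H_i^T\bigl(y_i(t)-H_ix_i(t)\bigr)+\beta(t)\sum_{j\in\mathcal N_i}\bigl(\hat x_j(t)-x_i(t)\bigr).$$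 Assume that 1. $\mathcal G$ is connected (in particular $\mathcal V\neq\emptyset$); 2. $\sum_{i\in\mathcal V}H_i^TH_i$ has full rank $n$; 3. $\epsilon_1>0$ and $\mathbb E\|V(t)\|^{2+\epsilon_1}<\infty$ for all $t$, where $V(t)$ is the vector obtained by stacking the $v_i(t)$, $i\in\mathcal V$; 4. $\alpha(t)=\frac{a}{(t+1)^{\tau_1}}$ and $\beta(t)=\frac{b}{(t+1)^{\tau_2}}$, where $a,b>0$, $0<\tau_2\le\tau_1\le1$ and $\tau_1>\max\{\tau_2+\frac1{2+\epsilon_1},\frac12\}$; 5. $\rho_i=\rho_0$ for all $i\in\mathcal V$, where $0<\rho_0<\tau_1-\frac1{2+\epsilon_1}$. Let $0=t_0^i<t_1^i<t_2^i<\cdots$ be the successive triggering instants of agent $i$. Then $$\mathbb P\Bigl(\lim_{k\to\infty}(t_{k+1}^i-t_k^i)=\infty\Bigr)=1\qquad\text{for all } i\in\mathcal V,$$ where, if agent $i$ has only finitely many triggering instants, $t_{k+1}^i-t_k^i$ is understood as $\infty$ for every $k$ for which $t_{k+1}^i$ does not exist. -/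

import Mathlib

open Filter Topology MeasureTheory ProbabilityTheory

/-- The triggering event at time `t` for a trajectory `x`, when `s` is the latest triggering
time before `t`: `‖x(t) - x(s)‖ > 1 / (t+1)^ρ`. -/
def TriggerEvent {n : ℕ} (ρ : ℝ) (x : ℕ → EuclideanSpace ℝ (Fin n)) (s t : ℕ) : Prop :=
  ‖x t - x s‖ > 1 / ((t : ℝ) + 1) ^ ρ

open Classical in
/-- The latest triggering time up to and including `t`.
The initial time `0` counts as a triggering time (the initial estimate is sent out). -/
noncomputable def latestTrigger {n : ℕ} (ρ : ℝ) (x : ℕ → EuclideanSpace ℝ (Fin n)) : ℕ → ℕ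
  | 0 => 0
  | t + 1 =>
    if TriggerEvent ρ x (latestTrigger ρ x t) (t + 1) then t + 1 else latestTrigger ρ x t

/-- `t` is a triggering instant: the initial time, or a time at which the event occurs relative
to the latest triggering time before `t`. -/
def IsTriggerInstant {n : ℕ} (ρ : ℝ) (x : ℕ → EuclideanSpace ℝ (Fin n)) : ℕ → Prop
  | 0 => True
  | t + 1 => TriggerEvent ρ x (latestTrigger ρ x t) (t + 1)

/-- The `k`-th triggering instant: `t_0 = 0`, and `t_{k+1}` is the first triggering instant after
`t_k`, which is `∞` if there is none. -/
noncomputable def triggerTime {n : ℕ} (ρ : ℝ) (x : ℕ → EuclideanSpace ℝ (Fin n)) : ℕ → ℕ∞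
  | 0 => 0
  | k + 1 => sInf {s : ℕ∞ | ∃ t : ℕ, s = t ∧ triggerTime ρ x k < t ∧ IsTriggerInstant ρ x t}

open Classical in
/-- The length `t_{k+1} - t_k` of the `k`-th triggering interval, with value `∞` when there is
no `(k+1)`-st triggering instant (including when there is no `k`-th one). -/
noncomputable def triggerInterval {n : ℕ} (ρ : ℝ) (x : ℕ → EuclideanSpace ℝ (Fin n)) (k : ℕ) :
    ℕ∞ :=
  if triggerTime ρ x k = ⊤ then ⊤ else triggerTime ρ x (k + 1) - triggerTime ρ x k

/-- The event-triggered distributed estimator over the communication graph `G`, with measurement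
matrices `H i`, measurements `y i t`, step sizes `α`, `β` and threshold exponents `ρ i`.
Agent `i` uses, for each neighbour `j`, the estimate most recently sent out by `j`; it is
`x_j(t)` if `j` triggers at time `t`, and the stored one otherwise. -/
def IsEventTriggeredEstimator {V : Type*} [Fintype V] {n : ℕ} {m : V → ℕ}
    (G : SimpleGraph V) [DecidableRel G.Adj]
    (H : ∀ i : V, Matrix (Fin (m i)) (Fin n) ℝ) (α β : ℕ → ℝ) (ρ : V → ℝ)
    (y : ∀ i : V, ℕ → EuclideanSpace ℝ (Fin (m i)))
    (x : V → ℕ → EuclideanSpace ℝ (Fin n)) : Prop :=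
  ∀ (i : V) (t : ℕ),
    x i (t + 1) = x i t
      + α t • Matrix.toEuclideanLin (H i).transpose
          (y i t - Matrix.toEuclideanLin (H i) (x i t))
      + β t • ∑ j ∈ G.neighborFinset i, (x j (latestTrigger (ρ j) (x j) t) - x i t)

open Asymptotics

/-! The argument is pathwise. If the increments of an agent are `o(t^(-ρ₀))`, then over at most `N`
steps the estimate moves by `o(t^(-ρ₀))`, less than the threshold; so only finitely many intervals
have length at most `N` (`tendsto_triggerInterval_of_isLittleO`).

With `p = 2 + ε₁`, Borel–Cantelli gives noise `O(t^(1/p))` almost surely. The stacked error then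
satisfies `E(t+1) = E - β L E - α D E + R`, with Laplacian `L`, observation operator `D`, and `R`
collecting noise and broadcast error; `R = o(t^(-ρ₀))` because `ρ₀ < τ₁ - 1/p`.

`isLittleO_increment_of_two_time_scale` bounds each term. Contraction at rate `t^(-τ₁)` gives `E =
o(t^(τ₁-ρ₀))`, possibly growing, but enough for `α D E`. On the range of `L` contraction has the
faster rate `t^(-τ₂)`, so `L E = o(t^(τ₂-ρ₀))`, enough for `β L E`. -/

/-! ### Scalar contractions with polynomial step sizes -/

theorem tendsto_natCast_add_one_atTop : Tendsto (fun t : ℕ => (t : ℝ) + 1) atTop atTop :=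
  tendsto_atTop_add_const_right _ _ tendsto_natCast_atTop_atTop

theorem isLittleO_natCast_add_one_rpow {r s : ℝ} (h : r < s) :
    (fun t : ℕ => ((t : ℝ) + 1) ^ r) =o[atTop] fun t : ℕ => ((t : ℝ) + 1) ^ s := by
  refine isLittleO_of_tendsto (fun t ht => ?_) ?_
  · exact absurd ht (by positivity)
  · have := (tendsto_rpow_neg_atTop (sub_pos.2 h)).comp tendsto_natCast_add_one_atTop
    refine this.congr fun t => ?_
    have : (0 : ℝ) < (t : ℝ) + 1 := by positivity
    simp only [Function.comp_apply]
    rw [← Real.rpow_sub this, neg_sub]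

theorem tendsto_sum_natCast_add_one_rpow {c τ : ℝ} (hc : 0 < c) (hτ : τ ≤ 1) :
    Tendsto (fun N => ∑ t ∈ Finset.range N, c * ((t : ℝ) + 1) ^ (-τ)) atTop atTop := by
  rw [← not_summable_iff_tendsto_nat_atTop_of_nonneg (fun t => by positivity),
    summable_mul_left_iff hc.ne']
  intro h
  have := (Real.summable_one_div_nat_add_rpow 1 τ).1 (h.congr fun t => by
    have : (0 : ℝ) < (t : ℝ) + 1 := by positivity
    rw [abs_of_pos this, Real.rpow_neg this.le, one_div])
  linarith

/-- A nonnegative sequence that is eventually contracted by factors `1 - h t` with divergent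
`∑ h t` towards a perturbation that vanishes in the limit tends to zero. -/
theorem tendsto_zero_of_le_contraction {f h w : ℕ → ℝ} (hf : ∀ t, 0 ≤ f t)
    (hh : ∀ᶠ t in atTop, 0 ≤ h t ∧ h t ≤ 1)
    (hsum : Tendsto (fun N => ∑ t ∈ Finset.range N, h t) atTop atTop)
    (hw : Tendsto w atTop (𝓝 0))
    (hrec : ∀ᶠ t in atTop, f (t + 1) ≤ (1 - h t) * f t + h t * w t) :
    Tendsto f atTop (𝓝 0) := by
  rw [Metric.tendsto_atTop]
  intro ε hε
  have hwδ : ∀ᶠ t in atTop, w t ≤ ε / 2 := hw.eventually_le_const (by positivity)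
  obtain ⟨T, hT⟩ := eventually_atTop.1 (hh.and (hwδ.and hrec))
  -- Measured from the level `ε / 2`, the perturbation disappears and each step multiplies by `1 - h
  -- ≤ exp (-h)`.
  have key : ∀ k, f (T + k) - ε / 2 ≤
      Real.exp (-∑ t ∈ Finset.range k, h (T + t)) * |f T - ε / 2| := by
    intro k
    induction k with
    | zero =>
      rw [Finset.sum_range_zero, neg_zero, Real.exp_zero, one_mul]
      exact le_abs_self (f T - ε / 2)
    | succ k ih =>
      obtain ⟨⟨h0, h1⟩, hw1, hr⟩ := hT (T + k) (by omega)
      rw [Finset.sum_range_succ, neg_add, Real.exp_add]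
      have e1 : 1 - h (T + k) ≤ Real.exp (-h (T + k)) := by
        have := Real.add_one_le_exp (-h (T + k)); linarith
      have hpos : 0 ≤ Real.exp (-∑ t ∈ Finset.range k, h (T + t)) * |f T - ε / 2| := by positivity
      calc f (T + (k + 1)) - ε / 2
          ≤ (1 - h (T + k)) * (f (T + k) - ε / 2) := by
            have := mul_le_mul_of_nonneg_left hw1 h0
            rw [← add_assoc]; linarith
        _ ≤ (1 - h (T + k)) *
            (Real.exp (-∑ t ∈ Finset.range k, h (T + t)) * |f T - ε / 2|) :=
            mul_le_mul_of_nonneg_left ih (by linarith)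
        _ ≤ Real.exp (-h (T + k)) *
            (Real.exp (-∑ t ∈ Finset.range k, h (T + t)) * |f T - ε / 2|) :=
            mul_le_mul_of_nonneg_right e1 hpos
        _ = _ := by ring
  have hsum' : Tendsto (fun k => ∑ t ∈ Finset.range k, h (T + t)) atTop atTop := by
    have h1 := tendsto_atTop_add_const_right _ (-∑ t ∈ Finset.range T, h t)
      (hsum.comp (tendsto_add_atTop_nat T))
    refine h1.congr fun k => ?_
    simp only [Function.comp_apply]
    rw [add_comm k T, Finset.sum_range_add]
    ring
  have hlim : Tendsto (fun k => Real.exp (-∑ t ∈ Finset.range k, h (T + t)) * |f T - ε / 2|)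
      atTop (𝓝 0) := by
    have h1 := (Real.tendsto_exp_neg_atTop_nhds_zero.comp hsum').mul_const (|f T - ε / 2|)
    rwa [zero_mul] at h1
  obtain ⟨K, hK⟩ := eventually_atTop.1 (hlim.eventually_lt_const (half_pos hε))
  refine ⟨T + K, fun t ht => ?_⟩
  obtain ⟨k, rfl⟩ := Nat.exists_eq_add_of_le (show T ≤ t by omega)
  have h1 := key k
  have h2 := hK k (by omega)
  rw [Real.dist_eq, sub_zero, abs_of_nonneg (hf _)]
  linarith

/-- Polynomial decay rate of a sequence contracted by factors `1 - c (t + 1)^(-τ)`. -/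
theorem isLittleO_rpow_of_le_contraction {e w : ℕ → ℝ} {c τ γ : ℝ} (he : ∀ t, 0 ≤ e t)
    (hc : 0 < c) (hτ0 : 0 < τ) (hτγ : 0 ≤ γ ∧ τ ≤ 1 ∨ τ < 1)
    (hw : w =o[atTop] fun t : ℕ => ((t : ℝ) + 1) ^ γ)
    (hrec : ∀ᶠ t : ℕ in atTop,
      e (t + 1) ≤ (1 - c * ((t : ℝ) + 1) ^ (-τ)) * e t + c * ((t : ℝ) + 1) ^ (-τ) * w t) :
    e =o[atTop] fun t : ℕ => ((t : ℝ) + 1) ^ γ := by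
  have hτ1 : τ ≤ 1 := by rcases hτγ with h | h <;> linarith
  have hg0 : Tendsto (fun t : ℕ => c * ((t : ℝ) + 1) ^ (-τ)) atTop (𝓝 0) := by
    simpa using ((tendsto_rpow_neg_atTop hτ0).comp tendsto_natCast_add_one_atTop).const_mul c
  -- `q` is the price of normalising `e` by `(t + 1) ^ γ`. It is at most `1` if `γ ≥ 0`; otherwise
  -- it is `1 + O(1/t)`, which the contraction absorbs when `τ < 1`. Hence the two alternatives in
  -- `hτγ`.
  set q : ℕ → ℝ := fun t => ((t : ℝ) + 1) ^ γ / ((t : ℝ) + 2) ^ γ with hq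
  have hq0 : ∀ t, 0 < q t := fun t => by positivity
  have hq1 : ∀ᶠ t : ℕ in atTop, q t ≤ 1 + c * ((t : ℝ) + 1) ^ (-τ) / 2 := by
    by_cases hγ : 0 ≤ γ
    · refine Eventually.of_forall fun t => ?_
      have : q t ≤ 1 := by
        rw [hq]
        refine div_le_one_of_le₀ (Real.rpow_le_rpow (by positivity) (by linarith) hγ) (by positivity)
      have : 0 ≤ c * ((t : ℝ) + 1) ^ (-τ) / 2 := by positivity
      linarith
    · have hτ1' : τ < 1 := by rcases hτγ with h | h; exacts [absurd h.1 hγ, h]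
      have hlo := (isLittleO_natCast_add_one_rpow (neg_lt_neg hτ1')).bound
        (show 0 < c / (4 * -γ) by have : 0 < -γ := by linarith
                                  positivity)
      have hsm : Tendsto (fun t : ℕ => -γ * ((t : ℝ) + 1) ^ (-1 : ℝ)) atTop (𝓝 0) := by
        simpa using ((tendsto_rpow_neg_atTop one_pos).comp
          tendsto_natCast_add_one_atTop).const_mul (-γ)
      filter_upwards [hlo, hsm.eventually_le_const one_pos] with t h1 h2
      have hs : (0 : ℝ) < (t : ℝ) + 1 := by positivity
      have hγ' : 0 < -γ := by linarith
      have hinv : 0 ≤ -γ * ((t : ℝ) + 1) ^ (-1 : ℝ) := by positivity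
      rw [Real.norm_of_nonneg (by positivity), Real.norm_of_nonneg (by positivity)] at h1
      have h3 : q t ≤ Real.exp (-γ * ((t : ℝ) + 1) ^ (-1 : ℝ)) := by
        have e1 : q t = (((t : ℝ) + 2) / ((t : ℝ) + 1)) ^ (-γ) := by
          rw [hq, Real.div_rpow (by positivity) hs.le, Real.rpow_neg (by positivity),
            Real.rpow_neg hs.le]
          field_simp
        rw [e1, mul_comm, Real.exp_mul]
        refine Real.rpow_le_rpow (by positivity) ?_ hγ'.le
        have := Real.add_one_le_exp (((t : ℝ) + 1) ^ (-1 : ℝ))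
        refine le_trans (le_of_eq ?_) this
        rw [Real.rpow_neg_one]
        field_simp
        ring
      have h4 := Real.abs_exp_sub_one_le (x := -γ * ((t : ℝ) + 1) ^ (-1 : ℝ))
        (by rwa [abs_of_nonneg hinv])
      rw [abs_of_nonneg hinv] at h4
      have h5 := (le_abs_self _).trans h4
      have h6 : 2 * (-γ * ((t : ℝ) + 1) ^ (-1 : ℝ)) ≤ c * ((t : ℝ) + 1) ^ (-τ) / 2 := by
        calc 2 * (-γ * ((t : ℝ) + 1) ^ (-1 : ℝ))
            ≤ 2 * (-γ * (c / (4 * -γ) * ((t : ℝ) + 1) ^ (-τ))) := by gcongr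
          _ = c * ((t : ℝ) + 1) ^ (-τ) / 2 := by
            have := hγ'.ne'
            generalize -γ = p at *
            field_simp
            ring
      linarith
  have hwq : Tendsto (fun t : ℕ => 4 * |w t / ((t : ℝ) + 1) ^ γ|) atTop (𝓝 0) := by
    simpa using (hw.tendsto_div_nhds_zero.abs).const_mul 4
  refine isLittleO_of_tendsto (fun t ht => absurd ht (by positivity)) ?_
  -- Half of the contraction pays for `q`. The factor `4` in `hwq` combines `q ≤ 2` with this
  -- halving of the rate.
  refine tendsto_zero_of_le_contraction (h := fun t => c / 2 * ((t : ℝ) + 1) ^ (-τ))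
    (fun t => div_nonneg (he t) (by positivity)) ?_
    (tendsto_sum_natCast_add_one_rpow (by positivity) hτ1) hwq ?_
  · filter_upwards [hg0.eventually_le_const one_pos] with t ht
    exact ⟨by positivity, by linarith⟩
  · filter_upwards [hrec, hq1, hg0.eventually_le_const one_pos] with t h1 h2 h3
    set g := c * ((t : ℝ) + 1) ^ (-τ) with hg
    have hgpos : 0 ≤ g := by positivity
    have hp : 0 < ((t : ℝ) + 1) ^ γ := by positivity
    have hp2 : 0 < ((t : ℝ) + 2) ^ γ := by positivity
    have hf0 : 0 ≤ e t / ((t : ℝ) + 1) ^ γ := div_nonneg (he t) hp.le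
    have e0 : c / 2 * ((t : ℝ) + 1) ^ (-τ) = g / 2 := by rw [hg]; ring
    rw [e0]
    push_cast
    rw [add_assoc (t : ℝ) 1 1, one_add_one_eq_two]
    calc e (t + 1) / ((t : ℝ) + 2) ^ γ ≤ ((1 - g) * e t + g * w t) / ((t : ℝ) + 2) ^ γ := by gcongr
      _ = (1 - g) * q t * (e t / ((t : ℝ) + 1) ^ γ) + g * (q t * (w t / ((t : ℝ) + 1) ^ γ)) := by
        rw [hq]; field_simp
      _ ≤ (1 - g / 2) * (e t / ((t : ℝ) + 1) ^ γ) +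
          g / 2 * (4 * |w t / ((t : ℝ) + 1) ^ γ|) := by
        have i1 : (1 - g) * q t ≤ 1 - g / 2 := by
          have := mul_le_mul_of_nonneg_left h2 (show 0 ≤ 1 - g by linarith)
          nlinarith
        have i2 : q t * (w t / ((t : ℝ) + 1) ^ γ) ≤ 2 * |w t / ((t : ℝ) + 1) ^ γ| :=
          (mul_le_mul_of_nonneg_left (le_abs_self _) (hq0 t).le).trans
            (mul_le_mul_of_nonneg_right (by linarith) (abs_nonneg _))
        have i3 := mul_le_mul_of_nonneg_right i1 hf0
        have i4 := mul_le_mul_of_nonneg_left i2 hgpos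
        linarith

/-! ### Triggering instants and slow trajectories -/

section Trigger

variable {n : ℕ} {ρ : ℝ} {x : ℕ → EuclideanSpace ℝ (Fin n)}

theorem norm_latestTrigger_sub_le (t : ℕ) :
    ‖x (latestTrigger ρ x t) - x t‖ ≤ 1 / ((t : ℝ) + 1) ^ ρ := by
  cases t with
  | zero => simp [latestTrigger]
  | succ t =>
    rw [latestTrigger]
    split_ifs with h
    · rw [sub_self, norm_zero]; positivity
    · rw [TriggerEvent, not_lt] at h
      rwa [norm_sub_rev]

theorem latestTrigger_eq_self {s : ℕ} (hs : IsTriggerInstant ρ x s) : latestTrigger ρ x s = s := by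
  cases s with
  | zero => rfl
  | succ s => exact if_pos hs

theorem latestTrigger_eq_of_forall_not {s : ℕ} (hs : IsTriggerInstant ρ x s) (k : ℕ)
    (h : ∀ r, s < r → r ≤ s + k → ¬ IsTriggerInstant ρ x r) :
    latestTrigger ρ x (s + k) = s := by
  induction k with
  | zero => exact latestTrigger_eq_self hs
  | succ k ih =>
    have h1 : ¬ TriggerEvent ρ x (latestTrigger ρ x (s + k)) (s + k + 1) :=
      h (s + (k + 1)) (by omega) le_rfl
    rw [← add_assoc, latestTrigger, if_neg h1]
    exact ih fun r h1 h2 => h r h1 (by omega)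

theorem triggerTime_succ_mem {k : ℕ} (h : triggerTime ρ x (k + 1) ≠ ⊤) :
    ∃ t : ℕ, triggerTime ρ x (k + 1) = t ∧ triggerTime ρ x k < t ∧ IsTriggerInstant ρ x t := by
  rw [triggerTime] at h ⊢
  refine csInf_mem (s := {s : ℕ∞ | ∃ t : ℕ, s = t ∧ triggerTime ρ x k < t ∧
    IsTriggerInstant ρ x t}) (Set.nonempty_iff_ne_empty.2 fun h0 => h ?_)
  rw [h0, sInf_empty]

/-- Instants are strictly increasing naturals until they become `⊤`. This sends the short windows to
infinity with `k`. -/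
theorem natCast_le_triggerTime (k : ℕ) : (k : ℕ∞) ≤ triggerTime ρ x k := by
  induction k with
  | zero => simp
  | succ k ih =>
    by_cases h : triggerTime ρ x (k + 1) = ⊤
    · simp [h]
    · obtain ⟨t, h1, h2, -⟩ := triggerTime_succ_mem h
      rw [h1]
      exact_mod_cast Order.add_one_le_of_lt (ih.trans_lt h2)

theorem exists_isTriggerInstant_of_triggerTime_ne_top {k : ℕ} (h : triggerTime ρ x k ≠ ⊤) :
    ∃ s : ℕ, triggerTime ρ x k = s ∧ IsTriggerInstant ρ x s := by
  cases k with
  | zero => exact ⟨0, rfl, trivial⟩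
  | succ k =>
    obtain ⟨t, h1, -, h3⟩ := triggerTime_succ_mem h
    exact ⟨t, h1, h3⟩

/-- If a triggering interval has length at most `N`, then it is a window on which the trajectory
moves by more than the threshold. -/
theorem exists_threshold_lt_of_triggerInterval_le {k N : ℕ} (h : triggerInterval ρ x k ≤ N) :
    ∃ s t : ℕ, k ≤ s ∧ s ≤ t ∧ t ≤ s + N ∧ 1 / ((t : ℝ) + 1) ^ ρ < ‖x t - x s‖ := by
  unfold triggerInterval at h
  split_ifs at h with h0
  · simp at h
  have h1 : triggerTime ρ x (k + 1) ≠ ⊤ := by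
    intro h1
    obtain ⟨s, hs⟩ := ENat.ne_top_iff_exists.1 h0
    rw [h1, ← hs] at h
    simp at h
  obtain ⟨s, hs, hst⟩ := exists_isTriggerInstant_of_triggerTime_ne_top h0
  obtain ⟨t, ht, hlt, htt⟩ := triggerTime_succ_mem h1
  rw [hs, Nat.cast_lt] at hlt
  have hks := natCast_le_triggerTime (ρ := ρ) (x := x) k
  rw [hs, Nat.cast_le] at hks
  have htN : t ≤ s + N := by
    rw [ht, hs] at h
    have : t - s ≤ N := by exact_mod_cast h
    omega
  refine ⟨s, t, hks, hlt.le, htN, ?_⟩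
  obtain ⟨j, rfl⟩ := Nat.exists_eq_add_of_lt hlt
  -- Minimality of `t_{k+1}` excludes triggers strictly inside the window, so the event at `s + j +
  -- 1` is still measured against `x s`.
  have hno : ∀ r, s < r → r ≤ s + j → ¬ IsTriggerInstant ρ x r := by
    intro r h2 h3 h4
    have : triggerTime ρ x (k + 1) ≤ r := by
      rw [triggerTime]
      exact sInf_le ⟨r, rfl, by rw [hs]; exact_mod_cast h2, h4⟩
    rw [ht, Nat.cast_le] at this
    omega
  have h5 : TriggerEvent ρ x (latestTrigger ρ x (s + j)) (s + j + 1) := htt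
  rwa [latestTrigger_eq_of_forall_not hst j hno] at h5

theorem tendsto_triggerInterval_of_isLittleO (hρ : 0 < ρ)
    (h : (fun t => x (t + 1) - x t) =o[atTop] fun t : ℕ => ((t : ℝ) + 1) ^ (-ρ)) :
    Tendsto (fun k => triggerInterval ρ x k) atTop (𝓝 ⊤) := by
  rw [ENat.tendsto_nhds_top_iff_natCast_lt]
  intro N
  -- As `t + 1 ≤ (N + 1) * (s + 1)` on the window, `N` moves of size `δ (s + 1)^(-ρ)` reach at most
  -- the fraction `N / (N + 1)` of the threshold.
  set δ : ℝ := 1 / ((N + 1) * ((N : ℝ) + 1) ^ ρ) with hδ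
  have hδ0 : 0 < δ := by positivity
  obtain ⟨T, hT⟩ := eventually_atTop.1 (h.bound hδ0)
  refine eventually_atTop.2 ⟨T, fun k hk => ?_⟩
  by_contra hcon
  obtain ⟨s, t, hks, hst, htN, hlt⟩ := exists_threshold_lt_of_triggerInterval_le (not_lt.1 hcon)
  obtain ⟨j, rfl⟩ := Nat.exists_eq_add_of_le hst
  have hjN : j ≤ N := by omega
  have hs1 : (0 : ℝ) < (s : ℝ) + 1 := by positivity
  have hmove : ∀ j, ‖x (s + j) - x s‖ ≤ j * (δ * ((s : ℝ) + 1) ^ (-ρ)) := by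
    intro j
    induction j with
    | zero => simp
    | succ j ih =>
      have h1 := hT (s + j) (by omega)
      rw [Real.norm_of_nonneg (by positivity)] at h1
      have h2 : (((s + j : ℕ) : ℝ) + 1) ^ (-ρ) ≤ ((s : ℝ) + 1) ^ (-ρ) :=
        Real.rpow_le_rpow_of_nonpos hs1 (by push_cast; linarith [Nat.cast_nonneg (α := ℝ) j])
          (by linarith)
      have h3 := h1.trans (mul_le_mul_of_nonneg_left h2 hδ0.le)
      have h4 := norm_add_le (x (s + j + 1) - x (s + j)) (x (s + j) - x s)
      rw [sub_add_sub_cancel] at h4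
      rw [← add_assoc]
      push_cast
      linarith
  have h1 := hlt.trans_le (hmove j)
  have h2 : (((s + j : ℕ) : ℝ) + 1) ^ ρ ≤ ((N : ℝ) + 1) ^ ρ * ((s : ℝ) + 1) ^ ρ := by
    rw [← Real.mul_rpow (by positivity) hs1.le]
    refine Real.rpow_le_rpow (by positivity) ?_ hρ.le
    have : (j : ℝ) ≤ N := by exact_mod_cast hjN
    push_cast
    nlinarith [Nat.cast_nonneg (α := ℝ) N, Nat.cast_nonneg (α := ℝ) s]
  have h3 : 1 / (((N : ℝ) + 1) ^ ρ * ((s : ℝ) + 1) ^ ρ) < N * (δ * ((s : ℝ) + 1) ^ (-ρ)) := by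
    refine (one_div_le_one_div_of_le (by positivity) h2).trans_lt (h1.trans_le ?_)
    have : (j : ℝ) ≤ N := by exact_mod_cast hjN
    gcongr
  rw [hδ, Real.rpow_neg hs1.le] at h3
  have h4 : (N : ℝ) * (1 / ((N + 1) * ((N : ℝ) + 1) ^ ρ) * (((s : ℝ) + 1) ^ ρ)⁻¹) =
      N / (N + 1) * (1 / (((N : ℝ) + 1) ^ ρ * ((s : ℝ) + 1) ^ ρ)) := by
    field_simp
  rw [h4] at h3
  have h5 : (N : ℝ) / (N + 1) ≤ 1 := div_le_one_of_le₀ (by linarith) (by positivity)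
  have h6 : 0 < 1 / (((N : ℝ) + 1) ^ ρ * ((s : ℝ) + 1) ^ ρ) := by positivity
  nlinarith

end Trigger

/-! ### Almost sure noise growth -/

/-- Identically distributed random vectors with a finite `p`-th moment grow almost surely at most
like `t ^ (1 / p)`. -/
theorem ae_eventually_norm_rpow_le {Ω E : Type*} [MeasurableSpace Ω] {P : Measure Ω}
    [IsProbabilityMeasure P] [NormedAddCommGroup E] [MeasurableSpace E] [BorelSpace E]
    {v : ℕ → Ω → E} {p : ℝ} (hident : ∀ t, IdentDistrib (v t) (v 0) P P)
    (hint : Integrable (fun ω => ‖v 0 ω‖ ^ p) P) :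
    ∀ᵐ ω ∂P, ∀ᶠ t : ℕ in atTop, ‖v t ω‖ ^ p ≤ t := by
  let _ : MeasureSpace Ω := ⟨P⟩
  have hP : IsProbabilityMeasure (volume : Measure Ω) := ‹_›
  -- Integrability makes the tail probabilities of `‖v 0‖ ^ p` summable; equality of laws transfers
  -- this to the events needed for Borel–Cantelli.
  have hlt := tsum_prob_mem_Ioi_lt_top (Ω := Ω) hint fun ω => by positivity
  have hsum : ∑' t : ℕ, P {ω | ‖v t ω‖ ^ p ∈ Set.Ioi (t : ℝ)} ≠ ⊤ := by
    refine ne_of_lt (lt_of_eq_of_lt (tsum_congr fun t => ?_) hlt)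
    have hm : Measurable fun y : E => ‖y‖ ^ p := measurable_norm.pow_const p
    exact ((hident t).comp hm).measure_mem_eq measurableSet_Ioi
  filter_upwards [ae_eventually_notMem hsum] with ω hω
  filter_upwards [hω] with t ht
  simpa using ht

/-! ### Positive operators and the two-time-scale recursion -/

section Positive

variable {F : Type*} [NormedAddCommGroup F] [InnerProductSpace ℝ F]

/-- Expand the nonnegative form at `y - s • A y`; the quadratic term in `s` is at most `s * ‖A y‖ ^
2`. -/
theorem mul_norm_apply_sq_le_inner {A : F →L[ℝ] F} (hA : A.IsPositive) {s : ℝ} (hs : 0 ≤ s)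
    (hsA : s * ‖A‖ ≤ 1) (y : F) : s * ‖A y‖ ^ 2 ≤ inner ℝ (A y) y := by
  have h0 := hA.inner_nonneg_left (y - s • A y)
  have h1 : inner ℝ (A (A y)) y = ‖A y‖ ^ 2 := by
    rw [hA.inner_left_eq_inner_right, real_inner_self_eq_norm_sq]
  have h2 : inner ℝ (A (A y)) (A y) ≤ ‖A‖ * ‖A y‖ ^ 2 :=
    (real_inner_le_norm _ _).trans (by
      have := mul_le_mul_of_nonneg_right (A.le_opNorm (A y)) (norm_nonneg (A y))
      linarith)
  have h3 : inner ℝ (A (y - s • A y)) (y - s • A y) =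
      inner ℝ (A y) y - 2 * s * ‖A y‖ ^ 2 + s ^ 2 * inner ℝ (A (A y)) (A y) := by
    simp only [map_sub, map_smul, inner_sub_left, inner_sub_right, real_inner_smul_left,
      real_inner_smul_right, h1, real_inner_self_eq_norm_sq]
    ring
  have h4 := mul_le_mul_of_nonneg_left h2 (sq_nonneg s)
  have h5 := mul_le_mul_of_nonneg_right hsA (mul_nonneg hs (sq_nonneg ‖A y‖))
  rw [h3] at h0
  linarith

theorem apply_eq_zero_of_inner_eq_zero {A : F →L[ℝ] F} (hA : A.IsPositive) {y : F}
    (h : inner ℝ (A y) y = 0) : A y = 0 := by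
  have hpos : (0 : ℝ) < ‖A‖ + 1 := by positivity
  have h1 := mul_norm_apply_sq_le_inner hA (s := 1 / (‖A‖ + 1)) (by positivity)
    (by rw [one_div_mul_eq_div]; exact div_le_one_of_le₀ (by linarith) hpos.le) y
  rw [h] at h1
  have h2 : ‖A y‖ ^ 2 ≤ 0 := nonpos_of_mul_nonpos_right h1 (by positivity)
  simpa using le_antisymm h2 (sq_nonneg _)

/-- Expanding the square and using `‖A y‖² ≤ ⟨A y, y⟩` leaves `(1 - g) ‖y‖² ≤ (1 - g/2)² ‖y‖²`.
Coercivity is needed only at `y`, so `A` may have a kernel. -/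
theorem norm_sub_apply_le {A : F →L[ℝ] F} (hA : A.IsPositive) (hA1 : ‖A‖ ≤ 1) {g : ℝ}
    (hg : g ≤ 2) {y : F} (hgy : g * ‖y‖ ^ 2 ≤ inner ℝ (A y) y) :
    ‖y - A y‖ ≤ (1 - g / 2) * ‖y‖ := by
  have h1 := mul_norm_apply_sq_le_inner hA zero_le_one (by linarith) y
  have h2 := norm_sub_sq_real y (A y)
  rw [real_inner_comm] at h2
  refine (pow_le_pow_iff_left₀ (norm_nonneg _)
    (mul_nonneg (by linarith) (norm_nonneg _)) two_ne_zero).1 ?_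
  nlinarith [sq_nonneg (g * ‖y‖)]

/-- A quadratic form that is positive on the nonzero vectors of a subspace is coercive there. -/
theorem exists_mul_norm_sq_le_inner [FiniteDimensional ℝ F] (A : F →L[ℝ] F) (W : Submodule ℝ F)
    (hpos : ∀ y ∈ W, y ≠ 0 → 0 < inner ℝ (A y) y) :
    ∃ c : ℝ, 0 < c ∧ ∀ y ∈ W, c * ‖y‖ ^ 2 ≤ inner ℝ (A y) y := by
  have hK : IsCompact (Metric.sphere (0 : F) 1 ∩ W) :=
    (isCompact_sphere _ _).inter_right W.closed_of_finiteDimensional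
  have hnorm : ∀ y ∈ W, y ≠ 0 → (‖y‖⁻¹ • y) ∈ Metric.sphere (0 : F) 1 ∩ W := fun y hy h0 =>
    ⟨by simp [norm_smul, h0], W.smul_mem _ hy⟩
  rcases (Metric.sphere (0 : F) 1 ∩ (W : Set F)).eq_empty_or_nonempty with he | hne
  · refine ⟨1, one_pos, fun y hy => ?_⟩
    by_cases h0 : y = 0
    · simp [h0]
    · exact absurd (hnorm y hy h0) (by rw [he]; exact Set.notMem_empty _)
  · obtain ⟨u, ⟨hu1, huW⟩, hu⟩ := hK.exists_isMinOn hne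
      (f := fun y => inner ℝ (A y) y) (by fun_prop)
    have hu0 : u ≠ 0 := fun h => by simp [h] at hu1
    refine ⟨_, hpos u huW hu0, fun y hy => ?_⟩
    by_cases h0 : y = 0
    · simp [h0]
    · have h1 := isMinOn_iff.1 hu _ (hnorm y hy h0)
      have hy0 : 0 < ‖y‖ := norm_pos_iff.2 h0
      simp only [map_smul, real_inner_smul_left, real_inner_smul_right] at h1
      calc _ ≤ (‖y‖⁻¹ * (‖y‖⁻¹ * inner ℝ (A y) y)) * ‖y‖ ^ 2 := by gcongr
        _ = inner ℝ (A y) y := by field_simp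

/-- Growth rate of a perturbed contraction `y (t + 1) = (1 - A t) (y t) + R t`. -/
theorem isLittleO_of_perturbed_contraction {A : ℕ → F →L[ℝ] F} {y R : ℕ → F} {c τ γ : ℝ}
    (hA : ∀ t, (A t).IsPositive) (hA0 : Tendsto A atTop (𝓝 0)) (hc : 0 < c)
    (hcoer : ∀ t : ℕ, c * ((t : ℝ) + 1) ^ (-τ) * ‖y t‖ ^ 2 ≤ inner ℝ (A t (y t)) (y t))
    (hτ0 : 0 < τ) (hτγ : 0 ≤ γ ∧ τ ≤ 1 ∨ τ < 1)
    (hrec : ∀ t, y (t + 1) = y t - A t (y t) + R t)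
    (hR : R =o[atTop] fun t : ℕ => ((t : ℝ) + 1) ^ (γ - τ)) :
    y =o[atTop] fun t : ℕ => ((t : ℝ) + 1) ^ γ := by
  refine IsLittleO.of_norm_left ?_
  refine isLittleO_rpow_of_le_contraction (c := c / 2) (τ := τ)
    (w := fun t => 2 / c * (((t : ℝ) + 1) ^ τ * ‖R t‖)) (fun t => norm_nonneg _) (by positivity)
    hτ0 hτγ ?_ ?_
  · refine IsLittleO.const_mul_left ?_ _
    have h1 := (isBigO_refl (fun t : ℕ => ((t : ℝ) + 1) ^ τ) atTop).mul_isLittleO hR.norm_left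
    refine h1.congr_right fun t => ?_
    rw [← Real.rpow_add (by positivity)]
    congr 1
    ring
  · have hA1 : ∀ᶠ t in atTop, ‖A t‖ ≤ 1 := by
      have := hA0.norm
      rw [norm_zero] at this
      exact this.eventually_le_const one_pos
    have hg0 : Tendsto (fun t : ℕ => c * ((t : ℝ) + 1) ^ (-τ)) atTop (𝓝 0) := by
      simpa using ((tendsto_rpow_neg_atTop hτ0).comp tendsto_natCast_add_one_atTop).const_mul c
    filter_upwards [hA1, hg0.eventually_le_const two_pos] with t h1 h2
    have h3 := norm_sub_apply_le (hA t) h1 h2 (hcoer t)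
    have h4 : c / 2 * ((t : ℝ) + 1) ^ (-τ) * (2 / c * (((t : ℝ) + 1) ^ τ * ‖R t‖)) = ‖R t‖ := by
      rw [Real.rpow_neg (by positivity)]
      field_simp
    rw [h4, hrec t]
    refine (norm_add_le _ _).trans ?_
    linarith

/-- Increments of a two-time-scale linear recursion with positive operators `L` and `D`. -/
theorem isLittleO_increment_of_two_time_scale [FiniteDimensional ℝ F] {L D : F →L[ℝ] F}
    (hL : L.IsPositive) (hD : D.IsPositive) (hLD : ∀ y, L y = 0 → D y = 0 → y = 0)
    {a b τ₁ τ₂ ρ : ℝ} (ha : 0 < a) (hb : 0 < b) (hτ₂ : 0 < τ₂) (hτ₂₁ : τ₂ < τ₁) (hτ₁ : τ₁ ≤ 1)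
    (hρ : ρ ≤ τ₁) {E R : ℕ → F}
    (hE : ∀ t : ℕ, E (t + 1) = E t - (b * ((t : ℝ) + 1) ^ (-τ₂)) • L (E t)
      - (a * ((t : ℝ) + 1) ^ (-τ₁)) • D (E t) + R t)
    (hR : R =o[atTop] fun t : ℕ => ((t : ℝ) + 1) ^ (-ρ)) :
    (fun t => E (t + 1) - E t) =o[atTop] fun t : ℕ => ((t : ℝ) + 1) ^ (-ρ) := by
  have hL0 := hL.inner_nonneg_left
  have hD0 := hD.inner_nonneg_left
  have hstep : ∀ (k τ : ℝ), 0 < τ → Tendsto (fun t : ℕ => k * ((t : ℝ) + 1) ^ (-τ)) atTop (𝓝 0) :=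
    fun k τ hτ => by
      simpa using ((tendsto_rpow_neg_atTop hτ).comp tendsto_natCast_add_one_atTop).const_mul k
  have hτ₁0 : 0 < τ₁ := hτ₂.trans hτ₂₁
  have hscale : ∀ (k τ : ℝ) {u : ℕ → F}, (u =o[atTop] fun t : ℕ => ((t : ℝ) + 1) ^ (τ - ρ)) →
      (fun t : ℕ => (k * ((t : ℝ) + 1) ^ (-τ)) • u t) =o[atTop]
        fun t : ℕ => ((t : ℝ) + 1) ^ (-ρ) := by
    intro k τ u hu
    have h1 := ((isBigO_refl (fun t : ℕ => ((t : ℝ) + 1) ^ (-τ)) atTop).const_mul_left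
      k).smul_isLittleO hu
    refine h1.congr_right fun t => ?_
    rw [smul_eq_mul, ← Real.rpow_add (by positivity)]
    congr 1
    ring
  -- the estimation error
  have hEo : E =o[atTop] fun t : ℕ => ((t : ℝ) + 1) ^ (τ₁ - ρ) := by
    obtain ⟨c, hc, hcoer⟩ := exists_mul_norm_sq_le_inner (L + D) ⊤ fun y _ hy => by
      rw [add_apply, inner_add_left]
      refine lt_of_le_of_ne (add_nonneg (hL0 y) (hD0 y)) fun h => hy ?_
      have := hL0 y
      have := hD0 y
      exact hLD y (apply_eq_zero_of_inner_eq_zero hL (by linarith))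
        (apply_eq_zero_of_inner_eq_zero hD (by linarith))
    -- Both step sizes dominate `min a b * (t + 1)^(-τ₁)`, so coercivity of `L + D` suffices. Here
    -- `γ = τ₁ - ρ ≥ 0`, which permits `τ₁ = 1`.
    refine isLittleO_of_perturbed_contraction (c := min a b * c) (τ := τ₁) (R := R)
      (A := fun t : ℕ => (b * ((t : ℝ) + 1) ^ (-τ₂)) • L + (a * ((t : ℝ) + 1) ^ (-τ₁)) • D)
      (fun t => (hL.smul_of_nonneg (by positivity)).add (hD.smul_of_nonneg (by positivity)))
      (by simpa using ((hstep b τ₂ hτ₂).smul_const L).add ((hstep a τ₁ hτ₁0).smul_const D))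
      (by positivity) (fun t => ?_) hτ₁0 (Or.inl ⟨by linarith, hτ₁⟩) (fun t => ?_) ?_
    · have h1 := hcoer (E t) trivial
      have h2 : ((t : ℝ) + 1) ^ (-τ₁) ≤ ((t : ℝ) + 1) ^ (-τ₂) :=
        Real.rpow_le_rpow_of_exponent_le (by linarith [Nat.cast_nonneg (α := ℝ) t]) (by linarith)
      simp only [add_apply, smul_apply, inner_add_left,
        real_inner_smul_left] at h1 ⊢
      have h3 : min a b * ((t : ℝ) + 1) ^ (-τ₁) ≤ b * ((t : ℝ) + 1) ^ (-τ₂) :=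
        mul_le_mul (min_le_right _ _) h2 (by positivity) hb.le
      have h4 : min a b * ((t : ℝ) + 1) ^ (-τ₁) ≤ a * ((t : ℝ) + 1) ^ (-τ₁) :=
        mul_le_mul_of_nonneg_right (min_le_left _ _) (by positivity)
      have h5 := mul_le_mul_of_nonneg_right h3 (hL0 (E t))
      have h6 := mul_le_mul_of_nonneg_right h4 (hD0 (E t))
      have h7 := mul_le_mul_of_nonneg_left h1
        (show 0 ≤ min a b * ((t : ℝ) + 1) ^ (-τ₁) by positivity)
      linarith
    · rw [hE t]
      simp only [add_apply, smul_apply]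
      abel
    · exact hR.congr_right fun t => by congr 1; ring
  have hDE := hscale a τ₁ ((D.isBigO_comp E atTop).trans_isLittleO hEo)
  -- the disagreement
  have hLE : (fun t => L (E t)) =o[atTop] fun t : ℕ => ((t : ℝ) + 1) ^ (τ₂ - ρ) := by
    -- A symmetric operator has range meeting its kernel only in `0`, so `L` is coercive on its
    -- range.
    obtain ⟨c, hc, hcoer⟩ := exists_mul_norm_sq_le_inner L (LinearMap.range L.toLinearMap)
      fun y hy hy0 => by
        refine lt_of_le_of_ne (hL0 y) fun h => hy0 ?_
        obtain ⟨z, rfl⟩ := hy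
        have h1 := apply_eq_zero_of_inner_eq_zero hL h.symm
        have h2 := hL.inner_left_eq_inner_right (L z) z
        rw [ContinuousLinearMap.coe_coe] at h1 ⊢
        rw [h1, inner_zero_left] at h2
        exact inner_self_eq_zero.1 h2.symm
    -- Apply `L` to the recursion and treat `α D E` as forcing. The exponent `τ₂ - ρ` may be
    -- negative, so `τ₂ < 1` is used.
    refine isLittleO_of_perturbed_contraction (c := b * c) (τ := τ₂)
      (A := fun t : ℕ => (b * ((t : ℝ) + 1) ^ (-τ₂)) • L)
      (R := fun t : ℕ => L (R t - (a * ((t : ℝ) + 1) ^ (-τ₁)) • D (E t)))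
      (fun t => hL.smul_of_nonneg (by positivity))
      (by simpa using (hstep b τ₂ hτ₂).smul_const L)
      (by positivity) (fun t => ?_) hτ₂ (Or.inr (by linarith)) (fun t => ?_) ?_
    · have h1 := mul_le_mul_of_nonneg_left (hcoer (L (E t)) ⟨E t, rfl⟩)
        (show 0 ≤ b * ((t : ℝ) + 1) ^ (-τ₂) by positivity)
      rw [smul_apply, real_inner_smul_left]
      linarith
    · rw [hE t]
      simp only [map_add, map_sub, map_smul, smul_apply]
      abel
    · refine ((L.isBigO_comp _ atTop).trans_isLittleO (hR.sub hDE)).congr_right fun t => ?_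
      congr 1
      ring
  refine ((hR.sub hDE).sub (hscale b τ₂ hLE)).congr_left fun t => ?_
  rw [hE t]
  abel

end Positive

/-! ### Graph Laplacian, observability and the estimator -/

section Network

variable {V : Type*} [Fintype V] (G : SimpleGraph V) [DecidableRel G.Adj] {n : ℕ} {m : V → ℕ}
  (H : ∀ i : V, Matrix (Fin (m i)) (Fin n) ℝ)

/-- The Laplacian of `G` acting on stacked vectors. -/
noncomputable def stackedLaplacian :
    PiLp 2 (fun _ : V => EuclideanSpace ℝ (Fin n)) →L[ℝ]
      PiLp 2 (fun _ : V => EuclideanSpace ℝ (Fin n)) where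
  toFun E := WithLp.toLp 2 fun i => ∑ j ∈ G.neighborFinset i, (E i - E j)
  map_add' E E' := by
    ext1 i
    simp only [PiLp.add_apply, ← Finset.sum_add_distrib]
    exact Finset.sum_congr rfl fun j _ => by abel
  map_smul' c E := by
    ext1 i
    simp only [PiLp.smul_apply, RingHom.id_apply, Finset.smul_sum, smul_sub]
  cont := by fun_prop

/-- The block diagonal operator with blocks `(H i)ᵀ * H i`. -/
noncomputable def stackedObservation :
    PiLp 2 (fun _ : V => EuclideanSpace ℝ (Fin n)) →L[ℝ]
      PiLp 2 (fun _ : V => EuclideanSpace ℝ (Fin n)) where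
  toFun E := WithLp.toLp 2 fun i =>
    Matrix.toEuclideanLin (H i).transpose (Matrix.toEuclideanLin (H i) (E i))
  map_add' E E' := by
    ext1 i
    simp only [PiLp.add_apply, map_add]
  map_smul' c E := by
    ext1 i
    simp only [PiLp.smul_apply, RingHom.id_apply, map_smul]
  cont := (PiLp.continuous_toLp 2 _).comp <| continuous_pi fun i =>
    ((Matrix.toEuclideanLin (H i).transpose).continuous_of_finiteDimensional.comp
      (Matrix.toEuclideanLin (H i)).continuous_of_finiteDimensional).comp (PiLp.continuous_apply 2 _ i)

theorem stackedLaplacian_apply (E : PiLp 2 (fun _ : V => EuclideanSpace ℝ (Fin n))) (i : V) :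
    stackedLaplacian G E i = ∑ j ∈ G.neighborFinset i, (E i - E j) := rfl

theorem stackedObservation_apply (E : PiLp 2 (fun _ : V => EuclideanSpace ℝ (Fin n))) (i : V) :
    stackedObservation H E i =
      Matrix.toEuclideanLin (H i).transpose (Matrix.toEuclideanLin (H i) (E i)) := rfl

/-- Average the double sum with its copy under `i ↔ j`. Symmetry and positivity are both visible in
this form. -/
theorem inner_stackedLaplacian (E E' : PiLp 2 (fun _ : V => EuclideanSpace ℝ (Fin n))) :
    inner ℝ (stackedLaplacian G E) E' =
      1 / 2 * ∑ i, ∑ j, if G.Adj i j then inner ℝ (E i - E j) (E' i - E' j) else 0 := by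
  have h1 : inner ℝ (stackedLaplacian G E) E' =
      ∑ i, ∑ j, if G.Adj i j then inner ℝ (E i - E j) (E' i) else 0 := by
    rw [PiLp.inner_apply]
    refine Finset.sum_congr rfl fun i _ => ?_
    rw [stackedLaplacian_apply, sum_inner, ← Finset.sum_filter]
    refine Finset.sum_congr ?_ fun _ _ => rfl
    ext j
    simp
  have h2 : inner ℝ (stackedLaplacian G E) E' =
      ∑ i, ∑ j, if G.Adj i j then -inner ℝ (E i - E j) (E' j) else 0 := by
    rw [h1, Finset.sum_comm]
    refine Finset.sum_congr rfl fun i _ => Finset.sum_congr rfl fun j _ => ?_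
    simp only [G.adj_comm j i, ← inner_neg_left, neg_sub]
  have h3 : inner ℝ (stackedLaplacian G E) E' + inner ℝ (stackedLaplacian G E) E' =
      ∑ i, ∑ j, if G.Adj i j then inner ℝ (E i - E j) (E' i - E' j) else 0 := by
    nth_rw 1 [h1]
    rw [h2, ← Finset.sum_add_distrib]
    refine Finset.sum_congr rfl fun i _ => ?_
    rw [← Finset.sum_add_distrib]
    refine Finset.sum_congr rfl fun j _ => ?_
    split_ifs
    · rw [inner_sub_right]; ring
    · simp
  linarith

theorem inner_toEuclideanLin_transpose {k l : ℕ} (M : Matrix (Fin k) (Fin l) ℝ)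
    (u : EuclideanSpace ℝ (Fin k)) (w : EuclideanSpace ℝ (Fin l)) :
    inner ℝ (Matrix.toEuclideanLin M.transpose u) w = inner ℝ u (Matrix.toEuclideanLin M w) := by
  rw [← Matrix.conjTranspose_eq_transpose_of_trivial, Matrix.toEuclideanLin_conjTranspose_eq_adjoint,
    LinearMap.adjoint_inner_left]

theorem inner_stackedObservation (E E' : PiLp 2 (fun _ : V => EuclideanSpace ℝ (Fin n))) :
    inner ℝ (stackedObservation H E) E' =
      ∑ i, inner ℝ (Matrix.toEuclideanLin (H i) (E i)) (Matrix.toEuclideanLin (H i) (E' i)) := by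
  rw [PiLp.inner_apply]
  refine Finset.sum_congr rfl fun i _ => ?_
  rw [stackedObservation_apply, inner_toEuclideanLin_transpose]

theorem isPositive_stackedLaplacian : (stackedLaplacian (n := n) G).IsPositive := by
  refine (ContinuousLinearMap.isPositive_iff' _).2 ⟨?_, fun E => ?_⟩
  · rw [ContinuousLinearMap.isSelfAdjoint_iff_isSymmetric]
    intro E E'
    rw [ContinuousLinearMap.coe_coe, real_inner_comm _ E, inner_stackedLaplacian,
      inner_stackedLaplacian]
    simp only [real_inner_comm]
  · rw [inner_stackedLaplacian]
    refine mul_nonneg (by norm_num) (Finset.sum_nonneg fun i _ => Finset.sum_nonneg fun j _ => ?_)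
    split_ifs
    exacts [real_inner_self_nonneg, le_rfl]

theorem isPositive_stackedObservation : (stackedObservation H).IsPositive := by
  refine (ContinuousLinearMap.isPositive_iff' _).2 ⟨?_, fun E => ?_⟩
  · rw [ContinuousLinearMap.isSelfAdjoint_iff_isSymmetric]
    intro E E'
    rw [ContinuousLinearMap.coe_coe, real_inner_comm _ E, inner_stackedObservation,
      inner_stackedObservation]
    simp only [real_inner_comm]
  · rw [inner_stackedObservation]
    exact Finset.sum_nonneg fun i _ => real_inner_self_nonneg

variable {G}

theorem eq_of_stackedLaplacian_eq_zero (hG : G.Connected)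
    {E : PiLp 2 (fun _ : V => EuclideanSpace ℝ (Fin n))} (h : stackedLaplacian G E = 0) (i j : V) :
    E i = E j := by
  have h1 := inner_stackedLaplacian G E E
  rw [h, inner_zero_left] at h1
  have hterm : ∀ i j, 0 ≤ (if G.Adj i j then inner ℝ (E i - E j) (E i - E j) else 0 : ℝ) := by
    intro i j
    split_ifs
    exacts [real_inner_self_nonneg, le_rfl]
  have h2 : ∑ i, ∑ j, (if G.Adj i j then inner ℝ (E i - E j) (E i - E j) else 0 : ℝ) = 0 := by
    linarith
  rw [Finset.sum_eq_zero_iff_of_nonneg fun i _ => Finset.sum_nonneg fun j _ => hterm i j] at h2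
  have hadj : ∀ i j, G.Adj i j → E i = E j := by
    intro i j hij
    have h3 := h2 i (Finset.mem_univ i)
    rw [Finset.sum_eq_zero_iff_of_nonneg fun j _ => hterm i j] at h3
    have h4 := h3 j (Finset.mem_univ j)
    rw [if_pos hij, inner_self_eq_zero] at h4
    exact sub_eq_zero.1 h4
  obtain ⟨p⟩ := hG.preconnected i j
  induction p with
  | nil => rfl
  | cons hij _ ih => exact (hadj _ _ hij).trans ih

variable {H}

theorem apply_eq_zero_of_stackedObservation_eq_zero
    {E : PiLp 2 (fun _ : V => EuclideanSpace ℝ (Fin n))} (h : stackedObservation H E = 0) (i : V) :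
    Matrix.toEuclideanLin (H i) (E i) = 0 := by
  have h1 := inner_stackedObservation H E E
  rw [h, inner_zero_left, eq_comm,
    Finset.sum_eq_zero_iff_of_nonneg fun i _ => real_inner_self_nonneg] at h1
  exact inner_self_eq_zero.1 (h1 i (Finset.mem_univ i))

theorem eq_zero_of_rank_eq {M : Matrix (Fin n) (Fin n) ℝ} (hM : M.rank = n) {u : Fin n → ℝ}
    (hu : M.mulVec u = 0) : u = 0 := by
  have h1 : LinearMap.range M.mulVecLin = ⊤ :=
    Submodule.eq_top_of_finrank_eq (by simpa [Matrix.rank] using hM)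
  have h2 := LinearMap.injective_iff_surjective.2 (LinearMap.range_eq_top.1 h1)
  exact h2 (by simpa using hu)

/-- Connectedness forces all blocks to agree; the common vector is killed by every `H j`, hence by
the invertible sum. -/
theorem eq_zero_of_stackedLaplacian_of_stackedObservation (hG : G.Connected)
    (hobs : (∑ i, (H i).transpose * H i).rank = n)
    (E : PiLp 2 (fun _ : V => EuclideanSpace ℝ (Fin n)))
    (hL : stackedLaplacian G E = 0) (hD : stackedObservation H E = 0) : E = 0 := by
  ext1 i
  have h1 : ∀ j, (H j).mulVec (WithLp.ofLp (E i)) = 0 := fun j => by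
    have h2 := apply_eq_zero_of_stackedObservation_eq_zero hD j
    rw [eq_of_stackedLaplacian_eq_zero hG hL j i] at h2
    exact congrArg WithLp.ofLp h2
  have h3 : (∑ j, (H j).transpose * H j).mulVec (WithLp.ofLp (E i)) = 0 := by
    rw [Matrix.sum_mulVec]
    exact Finset.sum_eq_zero fun j _ => by rw [← Matrix.mulVec_mulVec, h1 j, Matrix.mulVec_zero]
  have h4 := eq_zero_of_rank_eq hobs h3
  rw [PiLp.zero_apply]
  ext1 k
  exact congrFun h4 k

theorem isLittleO_toLp {w : V → ℕ → EuclideanSpace ℝ (Fin n)} {g : ℕ → ℝ}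
    (h : ∀ i, w i =o[atTop] g) :
    (fun t => (WithLp.toLp 2 fun i => w i t : PiLp 2 fun _ : V => EuclideanSpace ℝ (Fin n)))
      =o[atTop] g :=
  ((PiLp.continuousLinearEquiv 2 ℝ fun _ : V => EuclideanSpace ℝ
    (Fin n)).symm.isBigO_comp (fun t i => w i t) atTop).trans_isLittleO (isLittleO_pi.2 h)

/-- Along a noise path growing at most like `t ^ (1 / p)`, the increments of the event-triggered
estimator are small compared with the triggering threshold. -/
theorem IsEventTriggeredEstimator.isLittleO_increment (hG : G.Connected)
    (hobs : (∑ i, (H i).transpose * H i).rank = n) {θ : EuclideanSpace ℝ (Fin n)}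
    {a b τ₁ τ₂ ρ p : ℝ} (ha : 0 < a) (hb : 0 < b) (hτ₂ : 0 < τ₂) (hτ₂₁ : τ₂ < τ₁) (hτ₁ : τ₁ ≤ 1)
    (hp : 0 < p) (hρ : ρ < τ₁ - 1 / p) {v : ∀ i : V, ℕ → EuclideanSpace ℝ (Fin (m i))}
    (hv : ∀ i, ∀ᶠ t : ℕ in atTop, ‖v i t‖ ^ p ≤ t) {x : V → ℕ → EuclideanSpace ℝ (Fin n)}
    (hx : IsEventTriggeredEstimator G H
      (fun t : ℕ => a / ((t : ℝ) + 1) ^ τ₁) (fun t : ℕ => b / ((t : ℝ) + 1) ^ τ₂)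
      (fun _ => ρ) (fun i t => Matrix.toEuclideanLin (H i) θ + v i t) x) (i : V) :
    (fun t => x i (t + 1) - x i t) =o[atTop] fun t : ℕ => ((t : ℝ) + 1) ^ (-ρ) := by
  set E : ℕ → PiLp 2 (fun _ : V => EuclideanSpace ℝ (Fin n)) :=
    fun t => WithLp.toLp 2 fun i => x i t - θ
  -- Inserting `x j t` in the coupling separates the true Laplacian from the broadcast error, which
  -- the trigger rule bounds by the threshold.
  set r : V → ℕ → EuclideanSpace ℝ (Fin n) := fun i t =>
    (a * ((t : ℝ) + 1) ^ (-τ₁)) • Matrix.toEuclideanLin (H i).transpose (v i t)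
      + (b * ((t : ℝ) + 1) ^ (-τ₂)) •
        ∑ j ∈ G.neighborFinset i, (x j (latestTrigger ρ (x j) t) - x j t) with hr
  have hdiv : ∀ (k τ : ℝ) (t : ℕ), k / ((t : ℝ) + 1) ^ τ = k * ((t : ℝ) + 1) ^ (-τ) :=
    fun k τ t => by rw [Real.rpow_neg (by positivity), div_eq_mul_inv]
  have hrate : ∀ (k τ s : ℝ) {u : ℕ → EuclideanSpace ℝ (Fin n)},
      (u =O[atTop] fun t : ℕ => ((t : ℝ) + 1) ^ s) → s - τ < -ρ →
      (fun t : ℕ => (k * ((t : ℝ) + 1) ^ (-τ)) • u t) =o[atTop]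
        fun t : ℕ => ((t : ℝ) + 1) ^ (-ρ) := by
    intro k τ s u hu hs
    have h1 := ((isBigO_refl (fun t : ℕ => ((t : ℝ) + 1) ^ (-τ)) atTop).const_mul_left k).smul hu
    refine (h1.congr_right fun t => ?_).trans_isLittleO (isLittleO_natCast_add_one_rpow hs)
    rw [smul_eq_mul, ← Real.rpow_add (by positivity)]
    congr 1
    ring
  have hr_o : ∀ i, r i =o[atTop] fun t : ℕ => ((t : ℝ) + 1) ^ (-ρ) := by
    intro i
    refine (hrate a τ₁ (1 / p) ?_ (by linarith)).add (hrate b τ₂ (-ρ) ?_ (by linarith))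
    · have hvO : v i =O[atTop] fun t : ℕ => ((t : ℝ) + 1) ^ (1 / p) := by
        refine IsBigO.of_bound 1 ?_
        filter_upwards [hv i] with t ht
        rw [one_mul, Real.norm_of_nonneg (by positivity)]
        calc ‖v i t‖ = (‖v i t‖ ^ p) ^ (1 / p) := by
              rw [← Real.rpow_mul (norm_nonneg _), mul_one_div_cancel hp.ne', Real.rpow_one]
          _ ≤ ((t : ℝ) + 1) ^ (1 / p) :=
              Real.rpow_le_rpow (by positivity) (by linarith) (by positivity)
      exact ((LinearMap.toContinuousLinearMap
        (Matrix.toEuclideanLin (H i).transpose)).isBigO_comp _ atTop).trans hvO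
    · refine IsBigO.fun_sum fun j _ => IsBigO.of_bound 1 (Eventually.of_forall fun t => ?_)
      rw [one_mul, Real.norm_of_nonneg (by positivity), Real.rpow_neg (by positivity), ← one_div]
      exact norm_latestTrigger_sub_le t
  have hrec : ∀ t : ℕ, E (t + 1) = E t - (b * ((t : ℝ) + 1) ^ (-τ₂)) • stackedLaplacian G (E t)
      - (a * ((t : ℝ) + 1) ^ (-τ₁)) • stackedObservation H (E t)
      + WithLp.toLp 2 fun i => r i t := by
    intro t
    ext1 i
    simp only [PiLp.add_apply, PiLp.sub_apply, PiLp.smul_apply, stackedLaplacian_apply,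
      stackedObservation_apply, E, hr, hx i t, hdiv]
    have h1 : ∑ j ∈ G.neighborFinset i, (x j (latestTrigger ρ (x j) t) - x i t) =
        ∑ j ∈ G.neighborFinset i, (x j (latestTrigger ρ (x j) t) - x j t) -
          ∑ j ∈ G.neighborFinset i, (x i t - θ - (x j t - θ)) := by
      rw [← Finset.sum_sub_distrib]
      exact Finset.sum_congr rfl fun j _ => by abel
    rw [h1]
    simp only [map_add, map_sub]
    module
  have hinc := isLittleO_increment_of_two_time_scale (isPositive_stackedLaplacian G)
    (isPositive_stackedObservation H)
    (eq_zero_of_stackedLaplacian_of_stackedObservation hG hobs) ha hb hτ₂ hτ₂₁ hτ₁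
    (by have : 0 < 1 / p := by positivity
        linarith) hrec (isLittleO_toLp hr_o)
  refine (IsBigO.of_bound 1 (Eventually.of_forall fun t => ?_)).trans_isLittleO hinc
  rw [one_mul]
  refine le_trans (le_of_eq ?_) (PiLp.norm_apply_le (E (t + 1) - E t) i)
  rw [PiLp.sub_apply]
  simp [E]

end Network

/-! ### Almost sure conclusion -/

theorem mainTheorem4
    {V : Type*} [Fintype V] (G : SimpleGraph V) [DecidableRel G.Adj]
    {n : ℕ} {m : V → ℕ}
    -- measurement matrices and the unknown parameter
    (H : ∀ i : V, Matrix (Fin (m i)) (Fin n) ℝ) (θ : EuclideanSpace ℝ (Fin n))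
    {Ω : Type*} [MeasurableSpace Ω] (P : Measure Ω) [IsProbabilityMeasure P]
    -- measurement noises: zero mean and i.i.d. in time for each agent (spatial correlation allowed)
    (v : ∀ i : V, ℕ → Ω → EuclideanSpace ℝ (Fin (m i)))
    (hv_meas : ∀ i t, Measurable (v i t))
    (hv_indep : ∀ i, iIndepFun (v i) P)
    (hv_ident : ∀ i t, IdentDistrib (v i t) (v i 0) P P)
    (hv_mean : ∀ i t, ∫ ω, v i t ω ∂P = 0)
    -- the graph is connected
    (hG : G.Connected)
    -- collective observability
    (hobs : (∑ i, (H i).transpose * H i).rank = n)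
    -- moment condition on the stacked noise vector
    (ε₁ : ℝ) (hε₁ : 0 < ε₁)
    (hmoment : ∀ t, Integrable
      (fun ω => ‖(WithLp.toLp 2 (fun i => v i t ω) :
        PiLp 2 (fun i : V => EuclideanSpace ℝ (Fin (m i))))‖ ^ (2 + ε₁)) P)
    -- step sizes
    (a b τ₁ τ₂ : ℝ) (ha : 0 < a) (hb : 0 < b)
    (hτ₂ : 0 < τ₂) (hτ₂₁ : τ₂ ≤ τ₁) (hτ₁ : τ₁ ≤ 1)
    (hτ : max (τ₂ + 1 / (2 + ε₁)) (1 / 2) < τ₁)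
    -- common threshold exponent
    (ρ₀ : ℝ) (hρ₀ : 0 < ρ₀) (hρ₀τ : ρ₀ < τ₁ - 1 / (2 + ε₁))
    -- the estimates, with arbitrary initial values
    (x : V → ℕ → Ω → EuclideanSpace ℝ (Fin n))
    (hx : ∀ ω, IsEventTriggeredEstimator G H
      (fun t : ℕ => a / ((t : ℝ) + 1) ^ τ₁) (fun t : ℕ => b / ((t : ℝ) + 1) ^ τ₂)
      (fun _ => ρ₀)
      (fun i t => Matrix.toEuclideanLin (H i) θ + v i t ω)
      (fun i t => x i t ω)) :
    ∀ i : V, ∀ᵐ ω ∂P,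
      Tendsto (fun k : ℕ => triggerInterval ρ₀ (fun t => x i t ω) k) atTop (𝓝 ⊤) := by
  intro i
  have hp : 0 < 2 + ε₁ := by linarith
  have hτ₂₁' : τ₂ < τ₁ := by
    have : 0 < 1 / (2 + ε₁) := by positivity
    linarith [(le_max_left _ _).trans_lt hτ]
  have hint : ∀ j, Integrable (fun ω => ‖v j 0 ω‖ ^ (2 + ε₁)) P := fun j => by
    refine (hmoment 0).mono' ((hv_meas j 0).norm.pow_const _).aestronglyMeasurable
      (Eventually.of_forall fun ω => ?_)
    rw [Real.norm_of_nonneg (by positivity)]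
    exact Real.rpow_le_rpow (norm_nonneg _)
      (PiLp.norm_apply_le (WithLp.toLp 2 fun i => v i 0 ω) j) hp.le
  have hgrowth : ∀ᵐ ω ∂P, ∀ j, ∀ᶠ t : ℕ in atTop, ‖v j t ω‖ ^ (2 + ε₁) ≤ t :=
    ae_all_iff.2 fun j => ae_eventually_norm_rpow_le (hv_ident j) (hint j)
  filter_upwards [hgrowth] with ω hω
  exact tendsto_triggerInterval_of_isLittleO hρ₀
    ((hx ω).isLittleO_increment hG hobs ha hb hτ₂ hτ₂₁' hτ₁ hp hρ₀τ hω i)
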